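/- Let $P,Q\in L_1(0,\pi)$ be complex-valued functions, and put $$B=\begin{pmatrix}-i&0\\0&i\end{pmatrix},\qquad V(x)=\begin{pmatrix}0&P(x)\\Q(x)&0\end{pmatrix},\qquad V^*(x)=\begin{pmatrix}0&\overline{Q(x)}\\\overline{P(x)}&0\end{pmatrix}.$$ Let $\langle\mathbf f,\mathbf g\rangle=\int_0^\pi\bigl(f_1(x)\overline{g_1(x)}+f_2(x)\overline{g_2(x)}\bigr)\,dx$ be the inner product of $\mathbb H=L_2(0,\pi)\oplus L_2(0,\pi)$ and $\|\cdot\|_{\mathbb H}$ the corresponding norm. For $\lambda\in\mathbb C$ consider the systems $$(1)\quad B\mathbf y'+V\mathbf y=\lambda\mathbf y,\qquad\qquad(1^*)\quad B\mathbf z'+V^*\mathbf z=\overline{\lambda}\,\mathbf z,$$ whose solutions are pairs of complex-valued functions absolutely continuous on $[0,\pi]$ (that is, in $W_1^1[0,\pi]$) that satisfy the equation almost everywhere on $(0,\pi)$. If $\mathbf y$ and $\mathbf z$ are solutions of $(1)$ and $(1^*)$, respectively, with the same $\lambda$, normalized by $\langle\mathbf y,\mathbf z\rangle=1$, then $\|\mathbf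 y\|_{\mathbb H}\|\mathbf z\|_{\mathbb H}\to\infty$ as $|\operatorname{Im}\lambda|\to\infty$. That is, for every $M\in\mathbb R$ there is an $R\in\mathbb R$, depending only on $P$, $Q$ and $M$, such that $\|\mathbf y\|_{\mathbb H}\|\mathbf z\|_{\mathbb H}\ge M$ for all $\lambda\in\mathbb C$ with $|\operatorname{Im}\lambda|\ge R$ and all solutions $\mathbf y$ of $(1)$ and $\mathbf z$ of $(1^*)$ with $\langle\mathbf y,\mathbf z\rangle=1$. -/

import Mathlib

open Complex MeasureTheory Set
open scoped Matrix ComplexConjugate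

noncomputable section

/-- The constant matrix `B = diag(-i, i)` of the Dirac system. -/
def diracB : Matrix (Fin 2) (Fin 2) ℂ := !![-I, 0; 0, I]

/-- The potential matrix `V(x)` with off-diagonal entries `P(x)` and `Q(x)`. -/
def diracV (P Q : ℝ → ℂ) (x : ℝ) : Matrix (Fin 2) (Fin 2) ℂ := !![0, P x; Q x, 0]

/-- The matrix `V*(x)` of the formally adjoint system. -/
def diracVStar (P Q : ℝ → ℂ) (x : ℝ) : Matrix (Fin 2) (Fin 2) ℂ :=
  !![0, conj (Q x); conj (P x), 0]

/-- `y` is a solution on `[0, π]` of `B y' + W y = μ y`: both components lie in `W_1^1[0, π]`,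
that is, they are absolutely continuous on `[0, π]` (so that they are differentiable almost
everywhere there), and the equation holds for almost every `x` in `(0, π)`. -/
structure IsDiracSolution (W : ℝ → Matrix (Fin 2) (Fin 2) ℂ) (μ : ℂ) (y : ℝ → Fin 2 → ℂ) :
    Prop where
  absolutelyContinuous : ∀ j, AbsolutelyContinuousOnInterval (fun x => y x j) 0 Real.pi
  equation : ∀ᵐ x ∂(volume.restrict (Ioo 0 Real.pi)),
    diracB *ᵥ (fun j => deriv (fun t => y t j) x) + W x *ᵥ y x = μ • y x

/-- The inner product of `L_2(0, π) ⊕ L_2(0, π)`, linear in the first argument. -/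
def hInner (f g : ℝ → Fin 2 → ℂ) : ℂ :=
  ∫ x in (0 : ℝ)..Real.pi, (f x 0 * conj (g x 0) + f x 1 * conj (g x 1))

/-- The norm of `L_2(0, π) ⊕ L_2(0, π)`. -/
def hNorm (f : ℝ → Fin 2 → ℂ) : ℝ :=
  √(∫ x in (0 : ℝ)..Real.pi, (‖f x 0‖ ^ 2 + ‖f x 1‖ ^ 2))

end

/-!
Let `b = |Im λ|`, which is to tend to infinity. In the free system (`P = Q = 0`) one component of
`y` is an exponential decaying at rate `b` away from the endpoint `0`, the other one decays away
from `π`, and in `z` the roles of the components are exchanged. Hence the products `y₁ z̄₁` and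
`y₂ z̄₂` entering `⟨y, z⟩` have constant modulus, of the order of `exp (-b π)` times the boundary
values `A, D` of `y` and `C, F` of `z` at the endpoints where the components are largest, whereas
`‖y‖² ≈ (A² + D²) / (2 b)` and `‖z‖² ≈ (C² + F²) / (2 b)`. So `⟨y, z⟩` is negligible compared with
`‖y‖ ‖z‖`, and normalizing it to `1` forces `‖y‖ ‖z‖` to be large.

The potential does not spoil this. By variation of constants (`norm_sub_exp_mul_le`) the deviation
from the free solutions is bounded by the kernel `exp (-b |x - t|)` applied to
`(|P| + |Q|) (|y₁| + |y₂|)`. Writing `b = 2 β`, the kernel of rate `β` applied to `|P| + |Q|` is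
uniformly at most `ε` for large `β`
(`exists_forall_integral_exp_neg_mul_abs_sub_mul_le`), and therefore the kernel of rate `2 β` maps
the profile `A exp (-β x) + D exp (-β (π - x))` to at most `ε` times itself
(`integral_exp_mul_expProfile_le`). Bounding the maximal quotient of `|y₁| + |y₂|` by this profile
then shows that the deviation is at most `2 ε` times the profile (`IsSplitPair.deviation_le`). Since
the square of the profile has an integral of order `(A² + D²) / b`, the deviation changes the
energies by a small factor only (`IsSplitPair.sq_add_sq_le_mul_integral`) and contributes at most
`O(ε) ‖y‖ ‖z‖` to the pairing (`IsSplitPair.integral_mul_add_mul_le_mul_sqrt`).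
-/

/-! ### Absolutely continuous solutions of a scalar linear equation -/

/-- Complex-valued mean value inequality for absolutely continuous functions. It reduces to the
real fundamental theorem of calculus by pairing `f` with the increment `f b - f a`. -/
theorem AbsolutelyContinuousOnInterval.norm_sub_le_integral {f : ℝ → ℂ} {a b : ℝ}
    (hf : AbsolutelyContinuousOnInterval f a b) {G : ℝ → ℝ} (hG : IntegrableOn G (uIoc a b))
    (h : ∀ᵐ x ∂(volume.restrict (uIoc a b)), ‖deriv f x‖ ≤ G x) :
    ‖f b - f a‖ ≤ ∫ x in uIoc a b, G x := by
  set w := f b - f a with hw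
  rcases eq_or_ne w 0 with hw0 | hw0
  · rw [hw0, norm_zero]
    exact integral_nonneg_of_ae (h.mono fun x hx => (norm_nonneg _).trans hx)
  have hAC : AbsolutelyContinuousOnInterval (fun t => inner ℝ w (f t)) a b := by
    refine squeeze_zero (fun t => Finset.sum_nonneg fun i _ => dist_nonneg) (fun t => ?_)
      (by simpa using Filter.Tendsto.const_mul ‖w‖ hf)
    rw [Finset.mul_sum]
    refine Finset.sum_le_sum fun i _ => ?_
    rw [Real.dist_eq, ← inner_sub_right, dist_eq_norm]
    exact abs_real_inner_le_norm _ _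
  have hint := hAC.integral_deriv_eq_sub
  rw [← inner_sub_right, ← hw, real_inner_self_eq_norm_sq] at hint
  have hdiff := hf.boundedVariationOn.ae_differentiableAt_of_mem_uIcc
  have hle : ∀ᵐ x ∂(volume.restrict (uIoc a b)),
      ‖deriv (fun t => inner ℝ w (f t)) x‖ ≤ ‖w‖ * G x := by
    filter_upwards [h, ae_restrict_of_ae hdiff, ae_restrict_mem measurableSet_uIoc]
      with x hx hd hm
    have hd' := (hd (uIoc_subset_uIcc hm)).hasDerivAt
    have : HasDerivAt (fun t => inner ℝ w (f t)) (inner ℝ w (deriv f x)) x := by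
      simpa using (hasDerivAt_const x w).inner ℝ hd'
    rw [this.deriv]
    exact (norm_inner_le_norm _ _).trans (by gcongr)
  have key : ‖w‖ ^ 2 ≤ ‖w‖ * ∫ x in uIoc a b, G x := by
    rw [← hint, ← integral_const_mul]
    refine (Real.le_norm_self _).trans
      (intervalIntegral.norm_integral_le_integral_norm_uIoc.trans ?_)
    exact integral_mono_of_nonneg (ae_of_all _ fun x => norm_nonneg _) (hG.const_mul _) hle
  have hpos : 0 < ‖w‖ := norm_pos_iff.mpr hw0
  rw [sq] at key
  exact le_of_mul_le_mul_left key hpos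

theorem MeasureTheory.IntegrableOn.continuous_mul {g f : ℝ → ℝ} {a b : ℝ}
    (hg : IntegrableOn g (uIoc a b)) (hf : Continuous f) :
    IntegrableOn (fun t => f t * g t) (uIoc a b) :=
  intervalIntegrable_iff.mp ((intervalIntegrable_iff.mpr hg).continuousOn_mul hf.continuousOn)

/-- Variation of constants in the form of an estimate: if `‖u' - κ u‖ ≤ g` almost everywhere,
then `u` differs from the exponential solution with the same value at `a` by at most the
propagated defect. The point `x` may lie on either side of `a`. -/
theorem norm_sub_exp_mul_le {u : ℝ → ℂ} {a x : ℝ} {κ : ℂ} {g : ℝ → ℝ}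
    (hu : AbsolutelyContinuousOnInterval u a x) (hg : IntegrableOn g (uIoc a x))
    (h : ∀ᵐ t ∂(volume.restrict (uIoc a x)), ‖deriv u t - κ * u t‖ ≤ g t) :
    ‖u x - exp (κ * (x - a)) * u a‖ ≤ ∫ t in uIoc a x, Real.exp (κ.re * (x - t)) * g t := by
  set F : ℝ → ℂ := fun t => exp (κ * (x - t)) • u t with hF
  have hE : AbsolutelyContinuousOnInterval (fun t : ℝ => exp (κ * ((x : ℂ) - t))) a x := by
    refine ContDiffOn.absolutelyContinuousOnInterval (ContDiff.contDiffOn ?_)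
    have : ContDiff ℝ 1 (fun t : ℝ => (t : ℂ)) := ofRealCLM.contDiff
    fun_prop
  have hFac : AbsolutelyContinuousOnInterval F a x := hE.fun_smul hu
  have hdiff := hu.boundedVariationOn.ae_differentiableAt_of_mem_uIcc
  have hcont : Continuous fun t : ℝ => Real.exp (κ.re * (x - t)) := by fun_prop
  have key := hFac.norm_sub_le_integral (G := fun t => Real.exp (κ.re * (x - t)) * g t) ?_ ?_
  · simpa [hF] using key
  · exact hg.continuous_mul hcont
  · filter_upwards [h, ae_restrict_of_ae hdiff, ae_restrict_mem measurableSet_uIoc]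
      with t ht hd hm
    have hd' := (hd (uIoc_subset_uIcc hm)).hasDerivAt
    have h1 : HasDerivAt (fun t : ℝ => exp (κ * ((x : ℂ) - t))) (-(κ * exp (κ * (x - t)))) t := by
      have h2 : HasDerivAt (fun t : ℝ => κ * ((x : ℂ) - t)) (κ * (0 - 1)) t :=
        ((hasDerivAt_const _ _).sub (hasDerivAt_id t).ofReal_comp).const_mul κ
      convert h2.cexp using 1
      ring
    have h3 : HasDerivAt F (exp (κ * (x - t)) * (deriv u t - κ * u t)) t :=
      (h1.smul hd').congr_deriv (by simp only [smul_eq_mul]; ring)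
    rw [h3.deriv, norm_mul, Complex.norm_exp]
    have : (κ * ((x : ℂ) - t)).re = κ.re * (x - t) := by
      rw [← ofReal_sub, re_mul_ofReal]
    rw [this]
    gcongr

/-! ### The exponential kernel -/

theorem integral_exp_neg_mul_abs_sub_le {β L x : ℝ} (hβ : 0 < β) (hx : x ∈ Icc 0 L) :
    ∫ t in Ioc 0 L, Real.exp (-β * |x - t|) ≤ 2 / β := by
  have hc : Continuous fun t : ℝ => Real.exp (-β * |x - t|) := by fun_prop
  rw [← intervalIntegral.integral_of_le (hx.1.trans hx.2),
    ← intervalIntegral.integral_add_adjacent_intervals (hc.intervalIntegrable 0 x)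
      (hc.intervalIntegrable x L)]
  have h1 : ∫ t in (0 : ℝ)..x, Real.exp (-β * |x - t|) = (1 - Real.exp (-β * x)) / β := by
    have : ∫ t in (0 : ℝ)..x, Real.exp (-β * |x - t|) =
        ∫ t in (0 : ℝ)..x, Real.exp (β * t - β * x) := by
      refine intervalIntegral.integral_congr fun t ht => ?_
      rw [uIcc_of_le hx.1] at ht
      simp only [abs_of_nonneg (sub_nonneg.mpr ht.2)]
      ring_nf
    rw [this, intervalIntegral.integral_comp_mul_sub _ hβ.ne', integral_exp]
    simp [div_eq_inv_mul]
  have h2 : ∫ t in x..L, Real.exp (-β * |x - t|) = (1 - Real.exp (-β * (L - x))) / β := by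
    have : ∫ t in x..L, Real.exp (-β * |x - t|) = ∫ t in x..L, Real.exp (β * x - β * t) := by
      refine intervalIntegral.integral_congr fun t ht => ?_
      rw [uIcc_of_le hx.2] at ht
      simp only [abs_of_nonpos (sub_nonpos.mpr ht.1)]
      ring_nf
    rw [this, intervalIntegral.integral_comp_sub_mul _ hβ.ne', integral_exp]
    simp [div_eq_inv_mul]
    ring_nf
    simp
  rw [h1, h2, ← add_div]
  gcongr
  linarith [Real.exp_pos (-β * x), Real.exp_pos (-β * (L - x))]

/-- Convolution of a fixed integrable function with `exp (-β |·|)` tends to zero uniformly as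
`β → ∞`: up to a small error in `L¹` the function is bounded, and the kernel has mass at most
`2 / β`. -/
theorem exists_forall_integral_exp_neg_mul_abs_sub_mul_le {L : ℝ} {q : ℝ → ℝ}
    (hq : IntegrableOn q (Ioc 0 L)) {ε : ℝ} (hε : 0 < ε) :
    ∃ β₀ > 0, ∀ β ≥ β₀, ∀ x ∈ Icc 0 L,
      ∫ t in Ioc 0 L, Real.exp (-β * |x - t|) * q t ≤ ε := by
  obtain ⟨g, hg, hgi⟩ := hq.exists_boundedContinuous_integral_sub_le (half_pos hε)
  refine ⟨4 * (‖g‖ + 1) / ε, by positivity, fun β hβ x hx => ?_⟩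
  have hβ0 : 0 < β := lt_of_lt_of_le (by positivity) hβ
  have hc : Continuous fun t : ℝ => Real.exp (-β * |x - t|) := by fun_prop
  have hEi : IntegrableOn (fun t => Real.exp (-β * |x - t|)) (Ioc 0 L) :=
    (hc.integrableOn_Icc).mono_set Ioc_subset_Icc_self
  have hi : IntegrableOn (fun t => ‖q t - g t‖ + ‖g‖ * Real.exp (-β * |x - t|)) (Ioc 0 L) :=
    (hq.sub hgi).norm.add (hEi.const_mul _)
  calc ∫ t in Ioc 0 L, Real.exp (-β * |x - t|) * q t
      ≤ ∫ t in Ioc 0 L, (‖q t - g t‖ + ‖g‖ * Real.exp (-β * |x - t|)) := by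
        refine integral_mono ?_ hi fun t => ?_
        · rw [← uIoc_of_le (hx.1.trans hx.2)] at hq ⊢
          exact hq.continuous_mul hc
        · have h1 : Real.exp (-β * |x - t|) ≤ 1 :=
            Real.exp_le_one_iff.mpr (by nlinarith [abs_nonneg (x - t)])
          have h2 : g t ≤ ‖g‖ := (Real.le_norm_self _).trans (g.norm_coe_le_norm t)
          have h3 : q t - g t ≤ ‖q t - g t‖ := Real.le_norm_self _
          have h4 := Real.exp_pos (-β * |x - t|)
          have h5 := norm_nonneg (q t - g t)
          simp only
          nlinarith
    _ ≤ ε / 2 + ‖g‖ * (2 / β) := by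
        refine (integral_add (hq.sub hgi).norm (hEi.const_mul _)).trans_le ?_
        rw [integral_const_mul]
        refine add_le_add hg ?_
        gcongr
        exact integral_exp_neg_mul_abs_sub_le hβ0 hx
    _ ≤ ε := by
        have : ‖g‖ * (2 / β) ≤ ε / 2 := by
          rw [ge_iff_le, div_le_iff₀ hε] at hβ
          rw [mul_div_assoc', div_le_iff₀ hβ0]
          nlinarith
        linarith

/-! ### Nearly decoupled pairs -/

/-- `u` and `v` are absolutely continuous on `[0, L]` and satisfy `u' ≈ -μ u`, `v' ≈ μ v` up to a
coupling of strength `q`. For `0 < μ.re` the component `u` decays away from `0` and `v` decays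
away from `L`. Only the size of the coupling is recorded, so that a Dirac system and its adjoint,
for either sign of the imaginary part of the spectral parameter, become instances. -/
structure IsSplitPair (L : ℝ) (μ : ℂ) (q : ℝ → ℝ) (u v : ℝ → ℂ) : Prop where
  left_ac : AbsolutelyContinuousOnInterval u 0 L
  right_ac : AbsolutelyContinuousOnInterval v 0 L
  left_eq : ∀ᵐ x ∂(volume.restrict (Ioo 0 L)), ‖deriv u x + μ * u x‖ ≤ q x * ‖v x‖
  right_eq : ∀ᵐ x ∂(volume.restrict (Ioo 0 L)), ‖deriv v x - μ * v x‖ ≤ q x * ‖u x‖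

/-- The sum of two exponentials of rate `β`, of heights `A` and `D`, decaying away from the
endpoints `0` and `L` respectively. -/
noncomputable def expProfile (β L A D x : ℝ) : ℝ :=
  A * Real.exp (-β * x) + D * Real.exp (-β * (L - x))

theorem continuous_expProfile (β L A D : ℝ) : Continuous (expProfile β L A D) := by
  unfold expProfile
  fun_prop

theorem expProfile_nonneg {β L A D : ℝ} (hA : 0 ≤ A) (hD : 0 ≤ D) (x : ℝ) :
    0 ≤ expProfile β L A D x := by
  unfold expProfile
  positivity

theorem expProfile_le_exp_mul {β L A D : ℝ} (hβ : 0 ≤ β) (hA : 0 ≤ A) (hD : 0 ≤ D) (x t : ℝ) :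
    expProfile β L A D t ≤ Real.exp (β * |x - t|) * expProfile β L A D x := by
  unfold expProfile
  rw [mul_add, mul_left_comm, mul_left_comm _ D, ← Real.exp_add, ← Real.exp_add]
  gcongr
  · nlinarith [le_abs_self (x - t)]
  · nlinarith [neg_abs_le (x - t)]

/-- The kernel of the doubled rate `2 β` maps a profile of rate `β` to a small multiple of
itself: half of the kernel absorbs the variation of the profile, the other half is small. -/
theorem integral_exp_mul_expProfile_le {β L A D ε x : ℝ} {q : ℝ → ℝ} (hβ : 0 ≤ β) (hA : 0 ≤ A)
    (hD : 0 ≤ D) (hq : IntegrableOn q (Ioc 0 L)) (hq0 : ∀ t, 0 ≤ q t) (hL : 0 ≤ L)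
    (hε : ∫ t in Ioc 0 L, Real.exp (-β * |x - t|) * q t ≤ ε) :
    ∫ t in Ioc 0 L, Real.exp (-(2 * β) * |x - t|) * (q t * expProfile β L A D t) ≤
      ε * expProfile β L A D x := by
  have hc : Continuous fun t : ℝ => Real.exp (-β * |x - t|) := by fun_prop
  rw [← uIoc_of_le hL] at hq hε ⊢
  refine le_trans ?_ (mul_le_mul_of_nonneg_right hε (expProfile_nonneg hA hD x))
  rw [← integral_mul_const]
  refine integral_mono_of_nonneg (ae_of_all _ fun t => ?_)
    ((hq.continuous_mul hc).mul_const _) (ae_of_all _ fun t => ?_)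
  · exact mul_nonneg (Real.exp_pos _).le (mul_nonneg (hq0 t) (expProfile_nonneg hA hD t))
  · have h1 := expProfile_le_exp_mul (L := L) hβ hA hD x t
    have h2 : Real.exp (-(2 * β) * |x - t|) * Real.exp (β * |x - t|) =
        Real.exp (-β * |x - t|) := by
      rw [← Real.exp_add]
      ring_nf
    calc Real.exp (-(2 * β) * |x - t|) * (q t * expProfile β L A D t)
        ≤ Real.exp (-(2 * β) * |x - t|) *
            (q t * (Real.exp (β * |x - t|) * expProfile β L A D x)) := by
          gcongr
          exact hq0 t
      _ = Real.exp (-β * |x - t|) * q t * expProfile β L A D x := by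
          rw [← h2]
          ring

/-! ### Deviation from pure exponentials -/

theorem abs_norm_sub_mul_exp_le (κ : ℂ) (s : ℝ) (w z : ℂ) :
    |‖w‖ - ‖z‖ * Real.exp (κ.re * s)| ≤ ‖w - exp (κ * s) * z‖ := by
  have h1 : ‖exp (κ * s) * z‖ = ‖z‖ * Real.exp (κ.re * s) := by
    rw [norm_mul, Complex.norm_exp, re_mul_ofReal, mul_comm]
  rw [← h1]
  exact abs_norm_sub_norm_le _ _

theorem norm_le_add_norm_sub_exp_mul (κ : ℂ) (s : ℝ) (w z : ℂ) :
    ‖w‖ ≤ ‖z‖ * Real.exp (κ.re * s) + ‖w - exp (κ * s) * z‖ := by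
  linarith [(abs_le.mp (abs_norm_sub_mul_exp_le κ s w z)).2]

namespace IsSplitPair

variable {L : ℝ} {μ : ℂ} {q : ℝ → ℝ} {u v : ℝ → ℂ}

theorem continuousOn_left (h : IsSplitPair L μ q u v) (hL : 0 ≤ L) : ContinuousOn u (Icc 0 L) := by
  simpa [uIcc_of_le hL] using h.left_ac.continuousOn

theorem continuousOn_right (h : IsSplitPair L μ q u v) (hL : 0 ≤ L) :
    ContinuousOn v (Icc 0 L) := by
  simpa [uIcc_of_le hL] using h.right_ac.continuousOn

/-- The sum of the deviations of the two components from pure exponentials, each started from the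
endpoint from which it decays, is bounded by the exponential kernel applied to the coupling. -/
theorem deviation_le_integral (h : IsSplitPair L μ q u v) (hL : 0 ≤ L)
    (hq : IntegrableOn q (Ioc 0 L)) (hq0 : ∀ t, 0 ≤ q t) {x : ℝ} (hx : x ∈ Icc 0 L) :
    ‖u x - exp (-μ * x) * u 0‖ + ‖v x - exp (-μ * (L - x)) * v L‖ ≤
      ∫ t in Ioc 0 L, Real.exp (-μ.re * |x - t|) * (q t * (‖u t‖ + ‖v t‖)) := by
  have hc : Continuous fun t : ℝ => Real.exp (-μ.re * |x - t|) := by fun_prop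
  have hqI : IntervalIntegrable q volume 0 L := by
    rwa [intervalIntegrable_iff, uIoc_of_le hL]
  have hcu := (h.continuousOn_left hL).norm
  have hcv := (h.continuousOn_right hL).norm
  have hu1 : IntegrableOn (fun t => q t * ‖u t‖) (uIoc 0 L) :=
    intervalIntegrable_iff.mp (hqI.mul_continuousOn (by rwa [uIcc_of_le hL]))
  have hv1 : IntegrableOn (fun t => q t * ‖v t‖) (uIoc 0 L) :=
    intervalIntegrable_iff.mp (hqI.mul_continuousOn (by rwa [uIcc_of_le hL]))
  have hu2 := hu1.continuous_mul hc
  have hv2 := hv1.continuous_mul hc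
  rw [uIoc_of_le hL] at hu1 hv1 hu2 hv2
  have hs1 : Ioc 0 x ⊆ Ioc 0 L := Ioc_subset_Ioc_right hx.2
  have hs2 : Ioc x L ⊆ Ioc 0 L := Ioc_subset_Ioc_left hx.1
  have hleft : ‖u x - exp (-μ * x) * u 0‖ ≤
      ∫ t in Ioc 0 x, Real.exp (-μ.re * |x - t|) * (q t * ‖v t‖) := by
    have hsub : uIcc 0 x ⊆ uIcc 0 L := by
      rw [uIcc_of_le hx.1, uIcc_of_le hL]
      exact Icc_subset_Icc_right hx.2
    have := norm_sub_exp_mul_le (κ := -μ) (h.left_ac.mono hsub)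
      (g := fun t => q t * ‖v t‖) (by rw [uIoc_of_le hx.1]; exact hv1.mono_set hs1) (by
        rw [uIoc_of_le hx.1, ← restrict_Ioo_eq_restrict_Ioc]
        refine ae_mono (Measure.restrict_mono (Ioo_subset_Ioo_right hx.2) le_rfl) ?_
        exact h.left_eq.mono fun t ht => by simpa using ht)
    rw [uIoc_of_le hx.1] at this
    refine (le_of_eq ?_).trans (this.trans_eq (setIntegral_congr_fun measurableSet_Ioc ?_))
    · simp
    · intro t ht
      simp [abs_of_nonneg (sub_nonneg.mpr ht.2)]
  have hright : ‖v x - exp (-μ * (L - x)) * v L‖ ≤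
      ∫ t in Ioc x L, Real.exp (-μ.re * |x - t|) * (q t * ‖u t‖) := by
    have hsub : uIcc L x ⊆ uIcc 0 L := by
      rw [uIcc_of_ge hx.2, uIcc_of_le hL]
      exact Icc_subset_Icc_left hx.1
    have := norm_sub_exp_mul_le (κ := μ) (h.right_ac.mono hsub)
      (g := fun t => q t * ‖u t‖) (by rw [uIoc_of_ge hx.2]; exact hu1.mono_set hs2) (by
        rw [uIoc_of_ge hx.2, ← restrict_Ioo_eq_restrict_Ioc]
        refine ae_mono (Measure.restrict_mono (Ioo_subset_Ioo_left hx.1) le_rfl) ?_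
        exact h.right_eq)
    rw [uIoc_of_ge hx.2] at this
    refine (le_of_eq ?_).trans (this.trans_eq (setIntegral_congr_fun measurableSet_Ioc ?_))
    · congr 4
      ring
    · intro t ht
      simp only [abs_of_neg (sub_neg.mpr ht.1)]
      ring_nf
  have hint : ∫ t in Ioc 0 L, Real.exp (-μ.re * |x - t|) * (q t * (‖u t‖ + ‖v t‖)) =
      (∫ t in Ioc 0 L, Real.exp (-μ.re * |x - t|) * (q t * ‖v t‖)) +
      ∫ t in Ioc 0 L, Real.exp (-μ.re * |x - t|) * (q t * ‖u t‖) := by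
    rw [← integral_add hv2 hu2]
    refine integral_congr_ae (ae_of_all _ fun t => ?_)
    ring
  rw [hint]
  refine add_le_add (hleft.trans ?_) (hright.trans ?_)
  · refine setIntegral_mono_set hv2 (ae_of_all _ fun t => ?_) hs1.eventuallyLE
    exact mul_nonneg (Real.exp_pos _).le (mul_nonneg (hq0 t) (norm_nonneg _))
  · refine setIntegral_mono_set hu2 (ae_of_all _ fun t => ?_) hs2.eventuallyLE
    exact mul_nonneg (Real.exp_pos _).le (mul_nonneg (hq0 t) (norm_nonneg _))

/-- If `‖u‖ + ‖v‖` is at most `K` times a profile, then the coupling integral in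
`deviation_le_integral` is at most `K * ε` times the same profile. -/
theorem integral_coupling_le (hL : 0 ≤ L)
    (hq : IntegrableOn q (Ioc 0 L)) (hq0 : ∀ t, 0 ≤ q t) {β ε A D K x : ℝ} (hβ : 0 ≤ β)
    (hμ : μ.re = 2 * β) (hA : 0 ≤ A) (hD : 0 ≤ D)
    (hε : ∫ t in Ioc 0 L, Real.exp (-β * |x - t|) * q t ≤ ε) (hK : 0 ≤ K)
    (hle : ∀ t ∈ Icc 0 L, ‖u t‖ + ‖v t‖ ≤ K * expProfile β L A D t) :
    ∫ t in Ioc 0 L, Real.exp (-μ.re * |x - t|) * (q t * (‖u t‖ + ‖v t‖)) ≤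
      K * ε * expProfile β L A D x := by
  have hc : Continuous fun t : ℝ => Real.exp (-(2 * β) * |x - t|) := by fun_prop
  have hi : IntegrableOn
      (fun t => Real.exp (-(2 * β) * |x - t|) * (q t * expProfile β L A D t)) (Ioc 0 L) := by
    rw [← uIoc_of_le hL] at hq ⊢
    refine ((hq.continuous_mul (continuous_expProfile β L A D)).continuous_mul hc).congr
      (ae_of_all _ fun t => ?_)
    ring
  rw [hμ, mul_assoc]
  refine le_trans ?_ (mul_le_mul_of_nonneg_left
    (integral_exp_mul_expProfile_le hβ hA hD hq hq0 hL hε) hK)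
  rw [← integral_const_mul]
  refine integral_mono_of_nonneg (ae_of_all _ fun t => ?_) (hi.const_mul _) ?_
  · exact mul_nonneg (Real.exp_pos _).le (mul_nonneg (hq0 t) (by positivity))
  · filter_upwards [ae_restrict_mem measurableSet_Ioc] with t ht
    calc Real.exp (-(2 * β) * |x - t|) * (q t * (‖u t‖ + ‖v t‖))
        ≤ Real.exp (-(2 * β) * |x - t|) * (q t * (K * expProfile β L A D t)) := by
          gcongr
          · exact hq0 t
          · exact hle t (Ioc_subset_Icc_self ht)
      _ = K * (Real.exp (-(2 * β) * |x - t|) * (q t * expProfile β L A D t)) := by ring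

/-- A continuity argument without iteration: the quotient of `‖u‖ + ‖v‖` by the profile attains
its maximum, which the integral inequality bounds by `2`. The heights `A` and `D` may exceed the
boundary values, so that the profile can be taken positive. -/
theorem norm_add_norm_le (h : IsSplitPair L μ q u v) (hL : 0 ≤ L)
    (hq : IntegrableOn q (Ioc 0 L)) (hq0 : ∀ t, 0 ≤ q t) {β ε : ℝ} (hβ : 0 ≤ β)
    (hμ : μ.re = 2 * β) (hε2 : ε ≤ 1 / 2)
    (hε : ∀ x ∈ Icc 0 L, ∫ t in Ioc 0 L, Real.exp (-β * |x - t|) * q t ≤ ε)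
    {A D : ℝ} (hA : ‖u 0‖ ≤ A) (hD : ‖v L‖ ≤ D) (hA0 : 0 < A) {x : ℝ} (hx : x ∈ Icc 0 L) :
    ‖u x‖ + ‖v x‖ ≤ 2 * expProfile β L A D x := by
  have hD0 : 0 ≤ D := (norm_nonneg _).trans hD
  have hpos : ∀ x, 0 < expProfile β L A D x := fun x => by
    unfold expProfile
    positivity
  have hcont : ContinuousOn (fun x => (‖u x‖ + ‖v x‖) / expProfile β L A D x) (Icc 0 L) :=
    ((h.continuousOn_left hL).norm.add (h.continuousOn_right hL).norm).div
      (continuous_expProfile β L A D).continuousOn fun x _ => (hpos x).ne'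
  obtain ⟨x₀, hx₀, hmax⟩ := isCompact_Icc.exists_isMaxOn (nonempty_Icc.mpr hL) hcont
  set K := (‖u x₀‖ + ‖v x₀‖) / expProfile β L A D x₀ with hK
  have hK0 : 0 ≤ K := div_nonneg (by positivity) (hpos x₀).le
  have hle : ∀ t ∈ Icc 0 L, ‖u t‖ + ‖v t‖ ≤ K * expProfile β L A D t := fun t ht =>
    (div_le_iff₀ (hpos t)).mp (hmax ht)
  have hdev := (h.deviation_le_integral hL hq hq0 hx₀).trans
    (integral_coupling_le hL hq hq0 hβ hμ hA0.le hD0 (hε x₀ hx₀) hK0 hle)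
  have hexp : ‖u 0‖ * Real.exp (-μ.re * x₀) + ‖v L‖ * Real.exp (-μ.re * (L - x₀)) ≤
      expProfile β L A D x₀ := by
    have h1 : 0 ≤ x₀ := hx₀.1
    have h2 : 0 ≤ L - x₀ := sub_nonneg.mpr hx₀.2
    unfold expProfile
    rw [hμ]
    gcongr <;> linarith
  have hu := norm_le_add_norm_sub_exp_mul (-μ) x₀ (u x₀) (u 0)
  have hv := norm_le_add_norm_sub_exp_mul (-μ) (L - x₀) (v x₀) (v L)
  rw [neg_re] at hu hv
  push_cast at hv
  have hKx : ‖u x₀‖ + ‖v x₀‖ = K * expProfile β L A D x₀ := by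
    rw [hK, div_mul_cancel₀ _ (hpos x₀).ne']
  have hK2 : K ≤ 2 := by
    have h1 : K * expProfile β L A D x₀ ≤ (1 + K * ε) * expProfile β L A D x₀ := by linarith
    have h2 := le_of_mul_le_mul_right h1 (hpos x₀)
    nlinarith
  exact (hle x hx).trans (mul_le_mul_of_nonneg_right hK2 (hpos x).le)

/-- Both components are pure exponentials, each decaying away from its own endpoint, up to an
error that is small relative to the profile of the halved rate. -/
theorem deviation_le (h : IsSplitPair L μ q u v) (hL : 0 ≤ L)
    (hq : IntegrableOn q (Ioc 0 L)) (hq0 : ∀ t, 0 ≤ q t) {β ε : ℝ} (hβ : 0 ≤ β)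
    (hμ : μ.re = 2 * β) (hε2 : ε ≤ 1 / 2)
    (hε : ∀ x ∈ Icc 0 L, ∫ t in Ioc 0 L, Real.exp (-β * |x - t|) * q t ≤ ε)
    {x : ℝ} (hx : x ∈ Icc 0 L) :
    ‖u x - exp (-μ * x) * u 0‖ + ‖v x - exp (-μ * (L - x)) * v L‖ ≤
      2 * ε * expProfile β L ‖u 0‖ ‖v L‖ x := by
  have hle : ∀ t ∈ Icc 0 L, ‖u t‖ + ‖v t‖ ≤ 2 * expProfile β L ‖u 0‖ ‖v L‖ t := by
    intro t ht
    -- raise the height at `0` by `δ / 2` to make the profile positive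
    refine le_of_forall_pos_le_add fun δ hδ => ?_
    have h1 := h.norm_add_norm_le hL hq hq0 hβ hμ hε2 hε (A := ‖u 0‖ + δ / 2)
      (by linarith) le_rfl (by positivity) ht
    have h2 : expProfile β L (‖u 0‖ + δ / 2) ‖v L‖ t =
        expProfile β L ‖u 0‖ ‖v L‖ t + δ / 2 * Real.exp (-β * t) := by
      unfold expProfile
      ring
    have h3 : Real.exp (-β * t) ≤ 1 := Real.exp_le_one_iff.mpr (by nlinarith [ht.1])
    nlinarith
  exact (h.deviation_le_integral hL hq hq0 hx).trans (integral_coupling_le hL hq hq0 hβ hμ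
    (norm_nonneg _) (norm_nonneg _) (hε x hx) zero_le_two hle)

end IsSplitPair

/-! ### Integrals of exponential profiles -/

theorem integral_exp_neg_mul {c L : ℝ} (hc : 0 < c) :
    ∫ x in (0 : ℝ)..L, Real.exp (-c * x) = (1 - Real.exp (-c * L)) / c := by
  rw [intervalIntegral.integral_comp_mul_left _ (neg_ne_zero.mpr hc.ne'), integral_exp]
  simp only [mul_zero, Real.exp_zero, smul_eq_mul]
  field_simp
  ring

theorem integral_exp_neg_mul_sub {c L : ℝ} (hc : 0 < c) :
    ∫ x in (0 : ℝ)..L, Real.exp (-c * (L - x)) = (1 - Real.exp (-c * L)) / c := by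
  rw [intervalIntegral.integral_comp_sub_left (fun x => Real.exp (-c * x)), sub_self, sub_zero,
    integral_exp_neg_mul hc]

theorem integral_expProfile {c L : ℝ} (hc : 0 < c) (A D : ℝ) :
    ∫ x in (0 : ℝ)..L, expProfile c L A D x = (A + D) * ((1 - Real.exp (-c * L)) / c) := by
  have h1 : Continuous fun x => A * Real.exp (-c * x) := by fun_prop
  have h2 : Continuous fun x => D * Real.exp (-c * (L - x)) := by fun_prop
  unfold expProfile
  rw [intervalIntegral.integral_add (h1.intervalIntegrable _ _) (h2.intervalIntegrable _ _),
    intervalIntegral.integral_const_mul, intervalIntegral.integral_const_mul,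
    integral_exp_neg_mul hc, integral_exp_neg_mul_sub hc, add_mul]

theorem expProfile_sq_le (β L A D x : ℝ) :
    expProfile β L A D x ^ 2 ≤ 2 * expProfile (2 * β) L (A ^ 2) (D ^ 2) x := by
  have h1 : Real.exp (-(2 * β) * x) = Real.exp (-β * x) ^ 2 := by
    rw [← Real.exp_nat_mul]; push_cast; ring_nf
  have h2 : Real.exp (-(2 * β) * (L - x)) = Real.exp (-β * (L - x)) ^ 2 := by
    rw [← Real.exp_nat_mul]; push_cast; ring_nf
  unfold expProfile
  rw [h1, h2]
  nlinarith [sq_nonneg (A * Real.exp (-β * x) - D * Real.exp (-β * (L - x)))]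

/-- Cauchy–Schwarz in the two heights. -/
theorem expProfile_mul_expProfile_le {β L A D C F : ℝ} (hC : 0 ≤ C) (hF : 0 ≤ F) (x : ℝ) :
    expProfile β L A D x * expProfile β L C F x ≤
      √(A ^ 2 + D ^ 2) * √(C ^ 2 + F ^ 2) * expProfile (2 * β) L 1 1 x := by
  have h1 : Real.exp (-(2 * β) * x) = Real.exp (-β * x) ^ 2 := by
    rw [← Real.exp_nat_mul]; push_cast; ring_nf
  have h2 : Real.exp (-(2 * β) * (L - x)) = Real.exp (-β * (L - x)) ^ 2 := by
    rw [← Real.exp_nat_mul]; push_cast; ring_nf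
  have key : ∀ a d e f : ℝ, a * e + d * f ≤ √(a ^ 2 + d ^ 2) * √(e ^ 2 + f ^ 2) := by
    intro a d e f
    rw [← Real.sqrt_mul (by positivity)]
    exact Real.le_sqrt_of_sq_le (by nlinarith [sq_nonneg (a * f - d * e)])
  have h3 := key A D (Real.exp (-β * x)) (Real.exp (-β * (L - x)))
  have h4 := key C F (Real.exp (-β * x)) (Real.exp (-β * (L - x)))
  set S := Real.exp (-β * x) ^ 2 + Real.exp (-β * (L - x)) ^ 2 with hS
  have hSs : √S * √S = S := Real.mul_self_sqrt (by positivity)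
  have h5 : expProfile (2 * β) L 1 1 x = S := by
    unfold expProfile
    rw [h1, h2, one_mul, one_mul]
  rw [h5]
  calc expProfile β L A D x * expProfile β L C F x
      ≤ (√(A ^ 2 + D ^ 2) * √S) * (√(C ^ 2 + F ^ 2) * √S) :=
        mul_le_mul h3 h4 (expProfile_nonneg hC hF x) (by positivity)
    _ = √(A ^ 2 + D ^ 2) * √(C ^ 2 + F ^ 2) * (√S * √S) := by ring
    _ = _ := by rw [hSs]

/-! ### Energy and pairing of split pairs -/

/-- Expansion of a sum of two products of perturbed exponentials: the leading terms multiply to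
`a * c`, and every other term contains a deviation. -/
theorem mul_add_mul_le_of_deviation {A D C F a c r r' ρ ρ' φ ψ ε : ℝ} (hr : 0 ≤ r)
    (hr' : 0 ≤ r') (hρ : 0 ≤ ρ) (hρ' : 0 ≤ ρ') (hφ : 0 ≤ φ) (hψ : 0 ≤ ψ) (hAa : A * a ≤ φ)
    (hDc : D * c ≤ φ) (hCa : C * a ≤ ψ) (hFc : F * c ≤ ψ) (hrr : r + r' ≤ 2 * ε * φ)
    (hρρ : ρ + ρ' ≤ 2 * ε * ψ) (hε : 0 ≤ ε) (hε1 : ε ≤ 1 / 4) :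
    (A * a + r) * (F * c + ρ') + (D * c + r') * (C * a + ρ) ≤
      (A * F + D * C) * (a * c) + 5 * ε * (φ * ψ) := by
  have h1 := mul_le_mul_of_nonneg_right hAa hρ'
  have h2 := mul_le_mul_of_nonneg_right hDc hρ
  have h3 := mul_le_mul_of_nonneg_left hFc hr
  have h4 := mul_le_mul_of_nonneg_left hCa hr'
  have h5 := mul_le_mul_of_nonneg_left hρρ hφ
  have h6 := mul_le_mul_of_nonneg_right hrr hψ
  have h7 : (r + r') * (ρ + ρ') ≤ (2 * ε * φ) * (2 * ε * ψ) := by gcongr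
  have h8 := mul_nonneg hr hρ
  have h9 := mul_nonneg hr' hρ'
  have h10 : ε * (ε * (φ * ψ)) ≤ 1 / 4 * (ε * (φ * ψ)) := by gcongr
  linarith

namespace IsSplitPair

variable {L : ℝ} {μ ν : ℂ} {q : ℝ → ℝ} {u v s t : ℝ → ℂ}

/-- The boundary values are controlled by the energy, with the weight `μ.re = 2 β` of the free
system up to a constant. -/
theorem sq_add_sq_le_mul_integral (h : IsSplitPair L μ q u v) (hL : 0 ≤ L)
    (hq : IntegrableOn q (Ioc 0 L)) (hq0 : ∀ t, 0 ≤ q t) {β ε : ℝ} (hβ : 0 < β)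
    (hμ : μ.re = 2 * β) (hε1 : ε ≤ 1 / 16) (hβL : 1 ≤ 4 * β * L)
    (hε : ∀ x ∈ Icc 0 L, ∫ t in Ioc 0 L, Real.exp (-β * |x - t|) * q t ≤ ε) :
    ‖u 0‖ ^ 2 + ‖v L‖ ^ 2 ≤ 32 * β * ∫ x in (0 : ℝ)..L, (‖u x‖ ^ 2 + ‖v x‖ ^ 2) := by
  set A := ‖u 0‖
  set D := ‖v L‖
  have hpt : ∀ x ∈ Icc 0 L, expProfile (4 * β) L (A ^ 2) (D ^ 2) x ≤
      2 * (‖u x‖ ^ 2 + ‖v x‖ ^ 2) + 1 / 16 * expProfile (2 * β) L (A ^ 2) (D ^ 2) x := by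
    intro x hx
    have hdev := h.deviation_le hL hq hq0 hβ.le hμ (by linarith) hε hx
    have hu := abs_norm_sub_mul_exp_le (-μ) x (u x) (u 0)
    have hv := abs_norm_sub_mul_exp_le (-μ) (L - x) (v x) (v L)
    push_cast at hv
    have hφ := expProfile_nonneg (β := β) (L := L) (norm_nonneg (u 0)) (norm_nonneg (v L)) x
    have hsq := expProfile_sq_le β L A D x
    have hE1 : Real.exp (-(4 * β) * x) = Real.exp (-(2 * β) * x) ^ 2 := by
      rw [← Real.exp_nat_mul]; push_cast; ring_nf
    have hE2 : Real.exp (-(4 * β) * (L - x)) = Real.exp (-(2 * β) * (L - x)) ^ 2 := by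
      rw [← Real.exp_nat_mul]; push_cast; ring_nf
    rw [neg_re, hμ] at hu hv
    have hr : expProfile (4 * β) L (A ^ 2) (D ^ 2) x =
        (A * Real.exp (-(2 * β) * x)) ^ 2 + (D * Real.exp (-(2 * β) * (L - x))) ^ 2 := by
      unfold expProfile
      rw [hE1, hE2]
      ring
    rw [hr]
    set r := ‖u x - exp (-μ * x) * u 0‖
    set ρ := ‖v x - exp (-μ * (L - x)) * v L‖
    have hr0 : 0 ≤ r := norm_nonneg _
    have hρ0 : 0 ≤ ρ := norm_nonneg _
    have h1 : (‖u x‖ - A * Real.exp (-(2 * β) * x)) ^ 2 ≤ r ^ 2 :=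
      sq_le_sq' (abs_le.mp hu).1 (abs_le.mp hu).2
    have h2 : (‖v x‖ - D * Real.exp (-(2 * β) * (L - x))) ^ 2 ≤ ρ ^ 2 :=
      sq_le_sq' (abs_le.mp hv).1 (abs_le.mp hv).2
    have h3 : r + ρ ≤ 1 / 8 * expProfile β L A D x := hdev.trans (by gcongr; linarith)
    have h4 : (r + ρ) ^ 2 ≤ (1 / 8 * expProfile β L A D x) ^ 2 := by gcongr
    nlinarith [sq_nonneg (2 * ‖u x‖ - A * Real.exp (-(2 * β) * x)),
      sq_nonneg (2 * ‖v x‖ - D * Real.exp (-(2 * β) * (L - x))), mul_nonneg hr0 hρ0]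
  have hcont : ContinuousOn (fun x => ‖u x‖ ^ 2 + ‖v x‖ ^ 2) (Icc 0 L) :=
    ((h.continuousOn_left hL).norm.pow 2).add ((h.continuousOn_right hL).norm.pow 2)
  have hi : IntervalIntegrable (fun x => ‖u x‖ ^ 2 + ‖v x‖ ^ 2) volume 0 L :=
    ContinuousOn.intervalIntegrable_of_Icc hL hcont
  have hi2 := (continuous_expProfile (2 * β) L (A ^ 2) (D ^ 2)).intervalIntegrable (μ := volume) 0 L
  have hmono := intervalIntegral.integral_mono_on hL
    ((continuous_expProfile (4 * β) L (A ^ 2) (D ^ 2)).intervalIntegrable 0 L)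
    ((hi.const_mul 2).add (hi2.const_mul (1 / 16))) hpt
  rw [intervalIntegral.integral_add (hi.const_mul 2) (hi2.const_mul (1 / 16)),
    intervalIntegral.integral_const_mul, intervalIntegral.integral_const_mul,
    integral_expProfile (by positivity), integral_expProfile (by positivity)] at hmono
  have hexp : Real.exp (-(4 * β) * L) ≤ 1 / 2 := by
    rw [neg_mul, Real.exp_neg, one_div]
    exact inv_anti₀ two_pos (by linarith [Real.add_one_le_exp (4 * β * L)])
  set G := A ^ 2 + D ^ 2 with hG
  have hG0 : 0 ≤ G := by positivity
  set N := ∫ x in (0 : ℝ)..L, (‖u x‖ ^ 2 + ‖v x‖ ^ 2)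
  have h1 : G * ((1 / 2) / (4 * β)) ≤ G * ((1 - Real.exp (-(4 * β) * L)) / (4 * β)) := by
    gcongr
    linarith
  have h2 : G * ((1 - Real.exp (-(2 * β) * L)) / (2 * β)) ≤ G * (1 / (2 * β)) := by
    gcongr
    linarith [Real.exp_pos (-(2 * β) * L)]
  have h3 : G * ((1 / 2) / (4 * β)) ≤ 2 * N + 1 / 16 * (G * (1 / (2 * β))) := by linarith
  have h4 : G * (3 / 32) ≤ 2 * β * N := by
    have := mul_le_mul_of_nonneg_left h3 hβ.le
    have e1 : β * (G * ((1 / 2) / (4 * β))) = G / 8 := by field_simp; ring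
    have e2 : β * (2 * N + 1 / 16 * (G * (1 / (2 * β)))) = 2 * β * N + G / 32 := by
      field_simp; ring
    linarith
  nlinarith

/-- The products `u t` and `v s` pair a decaying with a growing component. Their leading parts
are of the constant size `exp (-2 β L)`, and their error parts are small. -/
theorem integral_mul_add_mul_le (h : IsSplitPair L μ q u v) (h' : IsSplitPair L ν q s t)
    (hL : 0 ≤ L) (hq : IntegrableOn q (Ioc 0 L)) (hq0 : ∀ t, 0 ≤ q t) {β ε : ℝ} (hβ : 0 < β)
    (hμ : μ.re = 2 * β) (hν : ν.re = 2 * β) (hε0 : 0 ≤ ε) (hε1 : ε ≤ 1 / 16)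
    (hε : ∀ x ∈ Icc 0 L, ∫ t in Ioc 0 L, Real.exp (-β * |x - t|) * q t ≤ ε) :
    ∫ x in (0 : ℝ)..L, (‖u x‖ * ‖t x‖ + ‖v x‖ * ‖s x‖) ≤
      √(‖u 0‖ ^ 2 + ‖v L‖ ^ 2) * √(‖s 0‖ ^ 2 + ‖t L‖ ^ 2) *
        (L * Real.exp (-(2 * β) * L) + 5 * ε / β) := by
  set A := ‖u 0‖
  set D := ‖v L‖
  set C := ‖s 0‖
  set F := ‖t L‖
  have hA : 0 ≤ A := norm_nonneg _
  have hD : 0 ≤ D := norm_nonneg _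
  have hC : 0 ≤ C := norm_nonneg _
  have hF : 0 ≤ F := norm_nonneg _
  set G := √(A ^ 2 + D ^ 2) * √(C ^ 2 + F ^ 2) with hG
  have hG0 : 0 ≤ G := by positivity
  have hAF : A * F + D * C ≤ G := by
    rw [hG, ← Real.sqrt_mul (by positivity)]
    exact Real.le_sqrt_of_sq_le (by nlinarith [sq_nonneg (A * C - D * F)])
  have hpt : ∀ x ∈ Icc 0 L, ‖u x‖ * ‖t x‖ + ‖v x‖ * ‖s x‖ ≤
      G * Real.exp (-(2 * β) * L) + 5 * ε * G * expProfile (2 * β) L 1 1 x := by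
    intro x hx
    have hdev := h.deviation_le hL hq hq0 hβ.le hμ (by linarith) hε hx
    have hdev' := h'.deviation_le hL hq hq0 hβ.le hν (by linarith) hε hx
    have hu := norm_le_add_norm_sub_exp_mul (-μ) x (u x) (u 0)
    have hv := norm_le_add_norm_sub_exp_mul (-μ) (L - x) (v x) (v L)
    have hs := norm_le_add_norm_sub_exp_mul (-ν) x (s x) (s 0)
    have ht := norm_le_add_norm_sub_exp_mul (-ν) (L - x) (t x) (t L)
    push_cast at hv ht
    rw [neg_re, hμ] at hu hv
    rw [neg_re, hν] at hs ht
    have hE : Real.exp (-(2 * β) * x) * Real.exp (-(2 * β) * (L - x)) =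
        Real.exp (-(2 * β) * L) := by
      rw [← Real.exp_add]
      ring_nf
    have hprod := expProfile_mul_expProfile_le (β := β) (L := L) (A := A) (D := D) hC hF x
    have he1 : Real.exp (-(2 * β) * x) ≤ Real.exp (-β * x) :=
      Real.exp_le_exp.mpr (by nlinarith [hx.1])
    have he2 : Real.exp (-(2 * β) * (L - x)) ≤ Real.exp (-β * (L - x)) :=
      Real.exp_le_exp.mpr (by nlinarith [hx.2])
    have hφ : A * Real.exp (-(2 * β) * x) + D * Real.exp (-(2 * β) * (L - x)) ≤
        expProfile β L A D x := by
      unfold expProfile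
      gcongr
    have hψ : C * Real.exp (-(2 * β) * x) + F * Real.exp (-(2 * β) * (L - x)) ≤
        expProfile β L C F x := by
      unfold expProfile
      gcongr
    have hp1 := Real.exp_pos (-(2 * β) * x)
    have hp2 := Real.exp_pos (-(2 * β) * (L - x))
    set a := Real.exp (-(2 * β) * x)
    set c := Real.exp (-(2 * β) * (L - x))
    set r := ‖u x - exp (-μ * x) * u 0‖
    set r' := ‖v x - exp (-μ * (L - x)) * v L‖
    set ρ := ‖s x - exp (-ν * x) * s 0‖
    set ρ' := ‖t x - exp (-ν * (L - x)) * t L‖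
    set φ := expProfile β L A D x
    set ψ := expProfile β L C F x
    have hr : 0 ≤ r := norm_nonneg _
    have hr' : 0 ≤ r' := norm_nonneg _
    have hρ : 0 ≤ ρ := norm_nonneg _
    have hρ' : 0 ≤ ρ' := norm_nonneg _
    have hφ0 : 0 ≤ φ := expProfile_nonneg hA hD x
    have hψ0 : 0 ≤ ψ := expProfile_nonneg hC hF x
    have hAa : A * a ≤ φ := by linarith [mul_nonneg hD hp2.le]
    have hDc : D * c ≤ φ := by linarith [mul_nonneg hA hp1.le]
    have hCa : C * a ≤ ψ := by linarith [mul_nonneg hF hp2.le]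
    have hFc : F * c ≤ ψ := by linarith [mul_nonneg hC hp1.le]
    have h1 : ‖u x‖ * ‖t x‖ + ‖v x‖ * ‖s x‖ ≤
        (A * a + r) * (F * c + ρ') + (D * c + r') * (C * a + ρ) :=
      add_le_add (mul_le_mul hu ht (norm_nonneg _) (by positivity))
        (mul_le_mul hv hs (norm_nonneg _) (by positivity))
    have h2 := mul_add_mul_le_of_deviation hr hr' hρ hρ' hφ0 hψ0 hAa hDc hCa hFc hdev hdev' hε0
      (hε1.trans (by norm_num))
    have h3 : (A * F + D * C) * (a * c) ≤ G * Real.exp (-(2 * β) * L) := by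
      rw [hE]
      gcongr
    have h4 : 5 * ε * (φ * ψ) ≤ 5 * ε * (G * expProfile (2 * β) L 1 1 x) := by gcongr
    linarith
  have hi1 : IntervalIntegrable (fun x => ‖u x‖ * ‖t x‖ + ‖v x‖ * ‖s x‖) volume 0 L :=
    ContinuousOn.intervalIntegrable_of_Icc hL
      (((h.continuousOn_left hL).norm.mul (h'.continuousOn_right hL).norm).add
        ((h.continuousOn_right hL).norm.mul (h'.continuousOn_left hL).norm))
  have hi2 := ((continuous_expProfile (2 * β) L 1 1).intervalIntegrable (μ := volume) 0 L).const_mul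
    (5 * ε * G)
  have hmono := intervalIntegral.integral_mono_on hL hi1
    ((intervalIntegrable_const (c := G * Real.exp (-(2 * β) * L))).add hi2) hpt
  rw [intervalIntegral.integral_add intervalIntegrable_const hi2,
    intervalIntegral.integral_const, intervalIntegral.integral_const_mul,
    integral_expProfile (by positivity), sub_zero, smul_eq_mul] at hmono
  have h2 : (1 + 1) * ((1 - Real.exp (-(2 * β) * L)) / (2 * β)) ≤ 1 / β := by
    rw [one_add_one_eq_two, mul_div_assoc', mul_div_mul_left _ _ two_ne_zero]
    gcongr
    linarith [Real.exp_pos (-(2 * β) * L)]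
  calc _ ≤ _ := hmono
    _ ≤ L * (G * Real.exp (-(2 * β) * L)) + 5 * ε * G * (1 / β) := by gcongr
    _ = _ := by ring

/-- The pairing of two split pairs is small compared with the product of their `L²` norms. -/
theorem integral_mul_add_mul_le_mul_sqrt (h : IsSplitPair L μ q u v) (h' : IsSplitPair L ν q s t)
    (hL : 0 < L) (hq : IntegrableOn q (Ioc 0 L)) (hq0 : ∀ t, 0 ≤ q t) {β ε : ℝ}
    (hμ : μ.re = 2 * β) (hν : ν.re = 2 * β) (hε0 : 0 < ε) (hε1 : ε ≤ 1 / 16)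
    (hβL : 16 / (L * ε) ≤ β)
    (hε : ∀ x ∈ Icc 0 L, ∫ t in Ioc 0 L, Real.exp (-β * |x - t|) * q t ≤ ε) :
    ∫ x in (0 : ℝ)..L, (‖u x‖ * ‖t x‖ + ‖v x‖ * ‖s x‖) ≤
      161 * ε * (√(∫ x in (0 : ℝ)..L, (‖u x‖ ^ 2 + ‖v x‖ ^ 2)) *
        √(∫ x in (0 : ℝ)..L, (‖s x‖ ^ 2 + ‖t x‖ ^ 2))) := by
  have hβ : 0 < β := lt_of_lt_of_le (by positivity) hβL
  rw [div_le_iff₀ (by positivity)] at hβL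
  have hβL1 : 1 ≤ 4 * β * L := by nlinarith [mul_pos hβ hL]
  have h1 := h.sq_add_sq_le_mul_integral hL.le hq hq0 hβ hμ hε1 hβL1 hε
  have h2 := h'.sq_add_sq_le_mul_integral hL.le hq hq0 hβ hν hε1 hβL1 hε
  have h3 := h.integral_mul_add_mul_le h' hL.le hq hq0 hβ hμ hν hε0.le hε1 hε
  set N := ∫ x in (0 : ℝ)..L, (‖u x‖ ^ 2 + ‖v x‖ ^ 2)
  set N' := ∫ x in (0 : ℝ)..L, (‖s x‖ ^ 2 + ‖t x‖ ^ 2)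
  have hexp : 32 * β * L * Real.exp (-(2 * β) * L) ≤ ε := by
    -- `32 w ≤ ε * (2 w) ^ 2 / 2` for `w = β * L`, since `16 ≤ ε * w`
    have := Real.quadratic_le_exp_of_nonneg (x := 2 * β * L) (by positivity)
    rw [neg_mul, Real.exp_neg, ← div_eq_mul_inv, div_le_iff₀ (Real.exp_pos _)]
    have h5 : 32 * β * L ≤ ε * ((2 * β * L) ^ 2 / 2) := by
      nlinarith [mul_pos hβ hL, mul_le_mul_of_nonneg_right hβL (mul_pos hβ hL).le]
    refine h5.trans (mul_le_mul_of_nonneg_left ?_ hε0.le)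
    have : 0 < 2 * β * L := by positivity
    linarith
  have hGG : √(‖u 0‖ ^ 2 + ‖v L‖ ^ 2) * √(‖s 0‖ ^ 2 + ‖t L‖ ^ 2) ≤ 32 * β * (√N * √N') := by
    calc _ ≤ √(32 * β * N) * √(32 * β * N') := by gcongr
      _ = (√(32 * β) * √(32 * β)) * (√N * √N') := by
        rw [Real.sqrt_mul (by positivity) N, Real.sqrt_mul (by positivity) N']
        ring
      _ = _ := by rw [Real.mul_self_sqrt (by positivity)]
  refine h3.trans ?_
  calc _ ≤ 32 * β * (√N * √N') * (L * Real.exp (-(2 * β) * L) + 5 * ε / β) := by gcongr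
    _ = (32 * β * L * Real.exp (-(2 * β) * L) + 160 * ε) * (√N * √N') := by
      field_simp
      ring
    _ ≤ 161 * ε * (√N * √N') := by
      gcongr
      linarith

end IsSplitPair

/-! ### Dirac systems -/

namespace IsDiracSolution

variable {W : ℝ → Matrix (Fin 2) (Fin 2) ℂ} {p r : ℝ → ℂ} {q : ℝ → ℝ} {lam : ℂ}
  {y : ℝ → Fin 2 → ℂ}

/-- A solution of an off-diagonal Dirac system is a split pair with parameter `-i lam`, whose real
part is the imaginary part of `lam`. -/
theorem isSplitPair (h : IsDiracSolution W lam y) (hW : ∀ x, W x = !![0, p x; r x, 0])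
    (hp : ∀ x, ‖p x‖ ≤ q x) (hr : ∀ x, ‖r x‖ ≤ q x) :
    IsSplitPair Real.pi (-I * lam) q (fun x => y x 0) (fun x => y x 1) where
  left_ac := h.absolutelyContinuous 0
  right_ac := h.absolutelyContinuous 1
  left_eq := by
    filter_upwards [h.equation] with x hx
    have h0 := congrFun hx 0
    simp only [hW, diracB, Matrix.mulVec, dotProduct, Fin.sum_univ_two, Pi.add_apply,
      Pi.smul_apply, smul_eq_mul, Matrix.of_apply, Matrix.cons_val', Matrix.cons_val_zero,
      Matrix.cons_val_one, Matrix.cons_val_fin_one, zero_mul, zero_add, add_zero] at h0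
    have : deriv (fun x => y x 0) x + -I * lam * y x 0 = -I * (p x * y x 1) := by
      linear_combination I * h0 + deriv (fun x => y x 0) x * I_mul_I
    rw [this, norm_mul, norm_neg, norm_I, one_mul, norm_mul]
    exact mul_le_mul_of_nonneg_right (hp x) (norm_nonneg _)
  right_eq := by
    filter_upwards [h.equation] with x hx
    have h1 := congrFun hx 1
    simp only [hW, diracB, Matrix.mulVec, dotProduct, Fin.sum_univ_two, Pi.add_apply,
      Pi.smul_apply, smul_eq_mul, Matrix.of_apply, Matrix.cons_val', Matrix.cons_val_zero,
      Matrix.cons_val_one, Matrix.cons_val_fin_one, zero_mul, zero_add, add_zero] at h1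
    have : deriv (fun x => y x 1) x - -I * lam * y x 1 = I * (r x * y x 0) := by
      linear_combination -I * h1 + deriv (fun x => y x 1) x * I_mul_I
    rw [this, norm_mul, norm_I, one_mul, norm_mul]
    exact mul_le_mul_of_nonneg_right (hr x) (norm_nonneg _)

end IsDiracSolution

/-- Exchanging the two components reverses the sign of `μ`, and so exchanges the roles of the
endpoints. -/
theorem IsSplitPair.swap {L : ℝ} {μ : ℂ} {q : ℝ → ℝ} {u v : ℝ → ℂ} (h : IsSplitPair L μ q u v) :
    IsSplitPair L (-μ) q v u where
  left_ac := h.right_ac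
  right_ac := h.left_ac
  left_eq := by simpa only [neg_mul, ← sub_eq_add_neg] using h.right_eq
  right_eq := by simpa only [neg_mul, sub_neg_eq_add] using h.left_eq

theorem norm_hInner_le {y z : ℝ → Fin 2 → ℂ}
    (hy : ∀ j, ContinuousOn (fun x => y x j) (Icc 0 Real.pi))
    (hz : ∀ j, ContinuousOn (fun x => z x j) (Icc 0 Real.pi)) :
    ‖hInner y z‖ ≤ ∫ x in (0 : ℝ)..Real.pi, (‖y x 0‖ * ‖z x 0‖ + ‖y x 1‖ * ‖z x 1‖) := by
  refine intervalIntegral.norm_integral_le_of_norm_le Real.pi_pos.le (ae_of_all _ fun x _ => ?_)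
    (ContinuousOn.intervalIntegrable_of_Icc Real.pi_pos.le
      (((hy 0).norm.mul (hz 0).norm).add ((hy 1).norm.mul (hz 1).norm)))
  refine (norm_add_le _ _).trans_eq ?_
  simp

theorem lemma1 (P Q : ℝ → ℂ)
    (hP : IntegrableOn P (Ioo 0 Real.pi)) (hQ : IntegrableOn Q (Ioo 0 Real.pi)) :
    ∀ M : ℝ, ∃ R : ℝ, ∀ lam : ℂ, R ≤ |lam.im| →
      ∀ y z : ℝ → Fin 2 → ℂ,
        IsDiracSolution (diracV P Q) lam y →
        IsDiracSolution (diracVStar P Q) (conj lam) z →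
        hInner y z = 1 →
        M ≤ hNorm y * hNorm z := by
  intro M
  set q : ℝ → ℝ := fun x => ‖P x‖ + ‖Q x‖ with hqdef
  have hq0 : ∀ x, 0 ≤ q x := fun x => by positivity
  have hq : IntegrableOn q (Ioc 0 Real.pi) := by
    rw [integrableOn_Ioc_iff_integrableOn_Ioo]
    exact hP.norm.add hQ.norm
  -- chosen so that `1 ≤ 161 * ε * (‖y‖ * ‖z‖)` gives `|M| + 1 ≤ ‖y‖ * ‖z‖`
  set ε : ℝ := 1 / (161 * (|M| + 1)) with hεdef
  have hε0 : 0 < ε := by positivity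
  have hε1 : ε ≤ 1 / 16 := one_div_le_one_div_of_le (by norm_num) (by linarith [abs_nonneg M])
  obtain ⟨β₀, -, hβ₀⟩ := exists_forall_integral_exp_neg_mul_abs_sub_mul_le hq hε0
  refine ⟨2 * max β₀ (16 / (Real.pi * ε)), fun lam hlam y z hy hz hyz => ?_⟩
  set β := |lam.im| / 2 with hβ
  have hmax : max β₀ (16 / (Real.pi * ε)) ≤ β := by linarith
  have hker := hβ₀ β ((le_max_left _ _).trans hmax)
  have hβπ : 16 / (Real.pi * ε) ≤ β := (le_max_right _ _).trans hmax
  have hYp : IsSplitPair Real.pi (-I * lam) q (fun x => y x 0) (fun x => y x 1) :=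
    hy.isSplitPair (p := P) (r := Q) (fun x => rfl) (fun x => by simp [hqdef])
      (fun x => by simp [hqdef])
  have hZp : IsSplitPair Real.pi (-I * conj lam) q (fun x => z x 0) (fun x => z x 1) :=
    hz.isSplitPair (p := fun x => conj (Q x)) (r := fun x => conj (P x)) (fun x => rfl)
      (fun x => by simp [hqdef]) (fun x => by simp [hqdef])
  have key : ∫ x in (0 : ℝ)..Real.pi, (‖y x 0‖ * ‖z x 0‖ + ‖y x 1‖ * ‖z x 1‖) ≤
      161 * ε * (hNorm y * hNorm z) := by
    -- The component that decays away from `0` has to come first: the pairs `(y₀, y₁)` and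
    -- `(z₁, z₀)` if `0 ≤ lam.im`, and `(y₁, y₀)` and `(z₀, z₁)` otherwise.
    rcases le_total 0 lam.im with hs | hs
    · have h := hYp.integral_mul_add_mul_le_mul_sqrt hZp.swap Real.pi_pos hq hq0 (β := β)
        (by simp [hβ, abs_of_nonneg hs]; ring) (by simp [hβ, abs_of_nonneg hs]; ring)
        hε0 hε1 hβπ hker
      simpa only [hNorm, add_comm (‖z _ 1‖ ^ 2)] using h
    · have h := hYp.swap.integral_mul_add_mul_le_mul_sqrt hZp Real.pi_pos hq hq0 (β := β)
        (by simp [hβ, abs_of_nonpos hs]; ring) (by simp [hβ, abs_of_nonpos hs]; ring)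
        hε0 hε1 hβπ hker
      simpa only [hNorm, add_comm (‖y _ 1‖ ^ 2), add_comm (‖y _ 1‖ * _)] using h
  have hone := norm_hInner_le (y := y) (z := z)
    (fun j => by simpa [uIcc_of_le Real.pi_pos.le] using (hy.absolutelyContinuous j).continuousOn)
    (fun j => by simpa [uIcc_of_le Real.pi_pos.le] using (hz.absolutelyContinuous j).continuousOn)
  rw [hyz, norm_one] at hone
  have hfin := hone.trans key
  have h161 : 161 * ε = 1 / (|M| + 1) := by
    rw [hεdef]
    field_simp
  rw [h161, one_div, inv_mul_eq_div, le_div_iff₀ (by positivity), one_mul] at hfin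
  linarith [le_abs_self M]
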